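/- All spaces are Tychonoff and all maps are continuous. A map $f$ with domain $X$ is regarded as a map onto its image $f(X)$, up to a homeomorphism of the image. For maps $\varphi,f$ on $X$ write $\varphi\prec f$ if $f=g\circ\varphi$ for some continuous $g\colon\varphi(X)\to f(X)$, and let $w(T)$ be the weight of $T$, i.e. the least cardinality of a base of $T$, where finite values are replaced by $\aleph_0$. A family $\Psi$ of maps with domain $X$ is a *multiplicative lattice* on $X$ if (L1) for every map $f\colon X\to f(X)$ there is $\varphi\in\Psi$ with $\varphi\prec f$ and $w(\varphi(X))\le w(f(X))$; (L2) for every subfamily $\{\varphi_\alpha:\alpha\in A\}\subset\Psi$, the diagonal product $\triangle\{\varphi_\alpha:\alpha\in A\}\colon X\to\prod_{\alpha\in A}\varphi_\alpha(X)$, regarded as a map onto its image, belongs to $\Psi$. A map $f\colon X\to Y$ is *semi-open* if $\mathrm{Int}_Y f(U)\ne\varnothing$ for every non-empty open $U\subset X$. The *absolute* of $X$ is the (unique up to homeomorphism) extremally disconnected Tychonoff space that admits a perfect irreducible map onto $X$ (irreducible: onto, and no proper closed subset is mapped onto $X$); two spaces are *co-absolute* if their absolutes are homeomorphic. **Theorem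 2.2.** Let $X$ be a space that has a multiplicative lattice consisting of open maps $\varphi\colon X\to\varphi(X)$. Then every space $Y$ co-absolute with $X$ has a multiplicative lattice consisting of semi-open maps $\psi\colon Y\to\psi(Y)$. -/

import Mathlib

open Topology Cardinal

universe u v

namespace CoAbs

/-- A map `φ : X → φ(X)` with domain `X`: a continuous surjection of `X` onto a Tychonoff space
(which has at most as many points as `X`, so that it may be taken in the universe of `X`). -/
structure MapFrom (X : Type u) [TopologicalSpace X] : Type (u + 1) where
  /-- the image `φ(X)` -/
  image : Type u
  [top : TopologicalSpace image]
  [tychonoff : T35Space image]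
  /-- the underlying function -/
  toFun : X → image
  continuous_toFun : Continuous toFun
  surjective_toFun : Function.Surjective toFun

attribute [instance] MapFrom.top MapFrom.tychonoff

/-- The weight `w(T)` of a topological space: the least cardinality of a base. As is customary for
cardinal functions, its values are infinite, i.e. finite values are replaced by `ℵ₀`. -/
noncomputable def weight (T : Type u) [TopologicalSpace T] : Cardinal.{u} :=
  max ℵ₀ (sInf {c : Cardinal.{u} | ∃ B : Set (Set T), TopologicalSpace.IsTopologicalBasis B ∧ c = #B})

/-- `φ ≺ f`: there is a continuous `g : φ(X) → f(X)` with `f = g ∘ φ`. -/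
def Refines {X : Type u} [TopologicalSpace X] (φ f : MapFrom X) : Prop :=
  ∃ g : φ.image → f.image, Continuous g ∧ f.toFun = g ∘ φ.toFun

/-- `ψ` is the diagonal product of the maps `φ a`, `a ∈ A`, regarded as a map of `X` onto its image
in the product of the spaces `φ a (X)`. A map onto its image is determined up to a homeomorphism of
the image, so `ψ(X)` need not be literally a subspace of the product: it is embedded in it, in such
a way that `ψ` becomes `x ↦ (φ a x)ₐ`. -/
def IsDiagonalProduct {X : Type u} [TopologicalSpace X] {A : Type v} (φ : A → MapFrom X)
    (ψ : MapFrom X) : Prop :=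
  ∃ e : ψ.image → (∀ a, (φ a).image), IsEmbedding e ∧ ∀ x a, e (ψ.toFun x) a = (φ a).toFun x

/-- A multiplicative lattice on `X` (in the sense of Shchepin). -/
structure IsMultiplicativeLattice {X : Type u} [TopologicalSpace X] (Ψ : Set (MapFrom X)) :
    Prop where
  /-- every map `f : X → f(X)` factors through some `φ ∈ Ψ` with `w(φ(X)) ≤ w(f(X))` -/
  exists_refines : ∀ f : MapFrom X, ∃ φ ∈ Ψ, Refines φ f ∧ weight φ.image ≤ weight f.image
  /-- the diagonal product of any subfamily of `Ψ` belongs to `Ψ` -/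
  diagonal_mem : ∀ S : Set (MapFrom X), S ⊆ Ψ →
    ∃ ψ ∈ Ψ, IsDiagonalProduct (fun φ : S => φ.1) ψ

/-- A map is semi-open if the image of every nonempty open set has nonempty interior. -/
def IsSemiOpenMap {S : Type u} {T : Type v} [TopologicalSpace S] [TopologicalSpace T]
    (f : S → T) : Prop :=
  ∀ U : Set S, IsOpen U → U.Nonempty → (interior (f '' U)).Nonempty

/-- A map is irreducible if it is onto and maps no proper closed subset onto its codomain. -/
def IsIrreducibleMap {S : Type u} {T : Type v} [TopologicalSpace S] (f : S → T) : Prop :=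
  Function.Surjective f ∧ ∀ F : Set S, IsClosed F → f '' F = Set.univ → F = Set.univ

/-- `Z` is (homeomorphic to) the absolute of `X`: an extremally disconnected Tychonoff space that
admits a perfect irreducible map onto `X`. (Between Hausdorff spaces the perfect maps, i.e. the
continuous closed maps with compact fibres, are the proper maps.) -/
def IsAbsolute (Z : Type u) (X : Type v) [TopologicalSpace Z] [TopologicalSpace X] : Prop :=
  T35Space Z ∧ ExtremallyDisconnected Z ∧
    ∃ θ : Z → X, IsProperMap θ ∧ IsIrreducibleMap θ

/-- Two spaces are co-absolute if they have the same absolute. -/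
def CoAbsolute (X Y : Type u) [TopologicalSpace X] [TopologicalSpace Y] : Prop :=
  ∃ (Z : Type u) (_ : TopologicalSpace Z), IsAbsolute Z X ∧ IsAbsolute Z Y

end CoAbs

/-!
Let `θ : Z → X` and `η : Z → Y` be perfect irreducible maps of the common absolute. A regular open
set of `X`, of `Y` or of `Z` is essentially the same thing, a clopen subset of `Z`. A map `φ` of `X`
is called matched with a map `ψ` of `Y` if the open sets of `φ(X)` and those of `ψ(Y)` give, by
taking preimages in `Z` and closures, the same clopen subsets of `Z` (`CoAbs.Matched`). The lattice
on `Y` consists of all maps that are matched with some member of the lattice `Ψ` on `X`.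

* Such maps are semi-open (`CoAbs.Matched.isSemiOpenMap`). If `φ` is open and matched with `ψ`, then
  the compact set `ψ(η(θ⁻¹(x)))` depends on `φ(x)` only. For open `U ⊆ Y` let `U'` be the set of the
  points `x` with `θ⁻¹(x) ⊆ η⁻¹(U)`. By matching, `ψ(Y)` has a non-empty open subset `V` whose
  preimage in `Z` lies over `φ(U')`, and then `V ⊆ ψ(U)`.
* Diagonal products of matched maps are matched (`CoAbs.Matched.iInf`), since in an extremally
  disconnected space the closures of open sets commute with finite intersections.
* Every map `f` of `Y` factors through a matched one of the same weight
  (`CoAbs.exists_matched_refines`). The space `X` satisfies the countable chain condition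
  (`CoAbs.IsMultiplicativeLattice.isCCC`): a countable closing-off argument gives an open map in the
  lattice for which enough cozero sets are saturated. The condition passes to `Z` and `Y`, so that
  every regular open set of `X` or `Y` comes from a map of countable weight. Closing off a subbase of
  `f(Y)` under going back and forth between `X` and `Y` gives at most `w(f(Y))` such maps, and the
  two diagonal products are matched.

A map of `X` is handled throughout as the coarser topology it induces on `X`
(`CoAbs.MapFrom.pullback`): then `≺` becomes the order of topologies and the diagonal product becomes
their infimum.
-/

universe w

namespace CoAbs

/-! ### Maps as coarser topologies -/

section Maps

variable {X : Type u} [tX : TopologicalSpace X]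

/-- The topology on `X` whose open sets are the `φ`-preimages of the open sets of `φ(X)`. Up to a
homeomorphism of the image, it determines the map `φ`. -/
@[reducible] def MapFrom.pullback (φ : MapFrom X) : TopologicalSpace X :=
  TopologicalSpace.induced φ.toFun φ.top

theorem MapFrom.isOpen_pullback_iff (φ : MapFrom X) {U : Set X} :
    IsOpen[φ.pullback] U ↔ ∃ V : Set φ.image, IsOpen V ∧ φ.toFun ⁻¹' V = U :=
  isOpen_induced_iff

theorem MapFrom.le_pullback (φ : MapFrom X) : tX ≤ φ.pullback :=
  continuous_iff_le_induced.1 φ.continuous_toFun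

/-- Sets that are open in the pullback topology are saturated. -/
theorem MapFrom.mem_of_isOpen_pullback (φ : MapFrom X) {U : Set X} (hU : IsOpen[φ.pullback] U)
    {x y : X} (hxy : φ.toFun x = φ.toFun y) (hx : x ∈ U) : y ∈ U := by
  obtain ⟨V, -, rfl⟩ := φ.isOpen_pullback_iff.1 hU
  simpa [← hxy] using hx

theorem refines_iff {φ f : MapFrom X} : Refines φ f ↔ φ.pullback ≤ f.pullback := by
  constructor
  · rintro ⟨g, hg, h⟩ U hU
    obtain ⟨V, hV, rfl⟩ := f.isOpen_pullback_iff.1 hU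
    exact φ.isOpen_pullback_iff.2 ⟨g ⁻¹' V, hV.preimage hg, by rw [h]; rfl⟩
  · intro h
    -- `f` is constant on the fibres of `φ`, since points of `f(X)` are separated by open sets
    have key : ∀ x y, φ.toFun x = φ.toFun y → f.toFun x = f.toFun y := by
      intro x y hxy
      refine Inseparable.eq (inseparable_iff_forall_isOpen.2 fun V hV => ?_)
      have hO : IsOpen[φ.pullback] (f.toFun ⁻¹' V) := h _ (f.isOpen_pullback_iff.2 ⟨V, hV, rfl⟩)
      exact ⟨fun hx => φ.mem_of_isOpen_pullback hO hxy hx,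
        fun hy => φ.mem_of_isOpen_pullback hO hxy.symm hy⟩
    have hfac : ∀ x, f.toFun (Function.surjInv φ.surjective_toFun (φ.toFun x)) = f.toFun x :=
      fun x => key _ _ (Function.surjInv_eq φ.surjective_toFun _)
    refine ⟨fun s => f.toFun (Function.surjInv φ.surjective_toFun s), ⟨fun V hV => ?_⟩,
      funext fun x => (hfac x).symm⟩
    obtain ⟨W, hW, hWV⟩ := φ.isOpen_pullback_iff.1 (h _ (f.isOpen_pullback_iff.2 ⟨V, hV, rfl⟩))
    convert hW
    ext s
    obtain ⟨x, rfl⟩ := φ.surjective_toFun s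
    have := Set.ext_iff.1 hWV x
    simp only [Set.mem_preimage, hfac] at this ⊢
    exact this.symm

/-- A continuous map of `X` into a Tychonoff space in any universe, regarded as a map onto its
image. The image is realised as the quotient of `X` by the kernel of the map. -/
theorem exists_mapFrom {T : Type v} [TopologicalSpace T] [T35Space T] {f : X → T}
    (hf : Continuous f) :
    ∃ (φ : MapFrom X) (e : φ.image → T), IsEmbedding e ∧ ∀ x, e (φ.toFun x) = f x := by
  let e : Quotient (Setoid.ker f) → T := Quotient.lift f fun _ _ h => h
  have einj : Function.Injective e := by
    rintro ⟨x⟩ ⟨y⟩ h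
    exact Quotient.sound h
  let _ : TopologicalSpace (Quotient (Setoid.ker f)) := TopologicalSpace.induced e inferInstance
  have he : IsEmbedding e := ⟨⟨rfl⟩, einj⟩
  have := he.t35Space
  exact ⟨⟨Quotient (Setoid.ker f), Quotient.mk _, he.continuous_iff.2 hf, Quotient.mk_surjective⟩,
    e, he, fun _ => rfl⟩

theorem pullback_eq_induced {T : Type v} [TopologicalSpace T] {f : X → T} {φ : MapFrom X}
    {e : φ.image → T} (he : IsEmbedding e) (h : ∀ x, e (φ.toFun x) = f x) :
    φ.pullback = TopologicalSpace.induced f inferInstance := by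
  have : f = e ∘ φ.toFun := funext fun x => (h x).symm
  rw [this, ← induced_compose, ← he.eq_induced]

theorem IsDiagonalProduct.pullback_eq {A : Type v} {φ : A → MapFrom X} {ψ : MapFrom X}
    (h : IsDiagonalProduct φ ψ) : ψ.pullback = ⨅ a, (φ a).pullback := by
  obtain ⟨e, he, hψ⟩ := h
  rw [pullback_eq_induced (f := fun x a => (φ a).toFun x) he fun x => funext (hψ x),
    induced_to_pi]

theorem exists_isDiagonalProduct {A : Type v} (φ : A → MapFrom X) :
    ∃ ψ : MapFrom X, IsDiagonalProduct φ ψ := by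
  obtain ⟨ψ, e, he, h⟩ := exists_mapFrom (f := fun x a => (φ a).toFun x)
    (continuous_pi fun a => (φ a).continuous_toFun)
  exact ⟨ψ, e, he, fun x a => congrFun (h x) a⟩

theorem IsMultiplicativeLattice.exists_pullback_eq_iInf {Ψ : Set (MapFrom X)}
    (hΨ : IsMultiplicativeLattice Ψ) {A : Type v} {φ : A → MapFrom X} (hφ : ∀ a, φ a ∈ Ψ) :
    ∃ ψ ∈ Ψ, ψ.pullback = ⨅ a, (φ a).pullback := by
  obtain ⟨ψ, hψ, h⟩ := hΨ.diagonal_mem (Set.range φ) (Set.range_subset_iff.2 hφ)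
  refine ⟨ψ, hψ, ?_⟩
  rw [h.pullback_eq]
  exact iInf_range' MapFrom.pullback φ

/-! ### Weight -/

theorem exists_basis_pullback (φ : MapFrom X) :
    ∃ ℬ : Set (Set X), #ℬ ≤ weight φ.image ∧
      @TopologicalSpace.IsTopologicalBasis X φ.pullback ℬ := by
  have hne : {c : Cardinal.{u} | ∃ B : Set (Set φ.image),
      TopologicalSpace.IsTopologicalBasis B ∧ c = #B}.Nonempty :=
    ⟨_, _, TopologicalSpace.isTopologicalBasis_opens, rfl⟩
  obtain ⟨B, hB, hc⟩ := csInf_mem hne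
  refine ⟨Set.preimage φ.toFun '' B, mk_image_le.trans ?_, hB.induced _⟩
  rw [← hc]
  exact le_max_right _ _

theorem weight_le_of_subbasis {φ : MapFrom X} {κ : Cardinal.{u}} (hκ : ℵ₀ ≤ κ)
    {𝒮 : Set (Set X)} (h𝒮 : #𝒮 ≤ κ) (h : φ.pullback = TopologicalSpace.generateFrom 𝒮) :
    weight φ.image ≤ κ := by
  have hB := @TopologicalSpace.isTopologicalBasis_of_subbasis X φ.pullback 𝒮 h
  set ℬ := (fun f => ⋂₀ f) '' {f : Set (Set X) | f.Finite ∧ f ⊆ 𝒮} with hℬ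
  have hcard : #ℬ ≤ κ := by
    have hsub : ℬ ⊆ Set.range fun l : List 𝒮 => ⋂₀ {s | ∃ t ∈ l, (t : Set X) = s} := by
      rintro _ ⟨f, ⟨hf, hf𝒮⟩, rfl⟩
      refine ⟨hf.toFinset.attach.toList.map fun t => ⟨t.1, hf𝒮 (hf.mem_toFinset.1 t.2)⟩, ?_⟩
      refine congrArg Set.sInter (Set.ext fun s => ?_)
      simpa using fun hs => hf𝒮 hs
    calc #ℬ ≤ #(List 𝒮) := (mk_le_mk_of_subset hsub).trans mk_range_le
      _ ≤ max ℵ₀ #𝒮 := mk_list_le_max _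
      _ ≤ κ := max_le hκ h𝒮
  let B : Set (Set φ.image) := {V | IsOpen V ∧ φ.toFun ⁻¹' V ∈ ℬ}
  have hBasis : TopologicalSpace.IsTopologicalBasis B := by
    refine TopologicalSpace.isTopologicalBasis_of_isOpen_of_nhds (fun V hV => hV.1) ?_
    intro s U hs hU
    obtain ⟨x, rfl⟩ := φ.surjective_toFun s
    obtain ⟨O, hO, hxO, hOU⟩ := @TopologicalSpace.IsTopologicalBasis.exists_subset_of_mem_open
      X φ.pullback ℬ hB x (φ.toFun ⁻¹' U) hs (φ.isOpen_pullback_iff.2 ⟨U, hU, rfl⟩)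
    obtain ⟨V, hV, rfl⟩ := φ.isOpen_pullback_iff.1
      (@TopologicalSpace.IsTopologicalBasis.isOpen X φ.pullback O ℬ hB hO)
    exact ⟨V, ⟨hV, hO⟩, hxO, (Set.preimage_subset_preimage_iff
      (by simp [φ.surjective_toFun.range_eq])).1 hOU⟩
  have hBℬ : #B ≤ #ℬ := mk_le_of_injective (f := fun V : B => (⟨φ.toFun ⁻¹' V.1, V.2.2⟩ : ℬ))
    fun V W h => Subtype.ext (φ.surjective_toFun.preimage_injective (Subtype.ext_iff.1 h))
  exact max_le hκ (csInf_le_of_le (OrderBot.bddBelow _) ⟨B, hBasis, rfl⟩ (hBℬ.trans hcard))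

/-- The diagonal product of at most `κ` maps of weight at most `κ` has weight at most `κ`. -/
theorem weight_le_of_pullback_eq_iInf {A : Type u} {φ : A → MapFrom X} {ψ : MapFrom X}
    (h : ψ.pullback = ⨅ a, (φ a).pullback) {κ : Cardinal.{u}} (hκ : ℵ₀ ≤ κ) (hA : #A ≤ κ)
    (hφ : ∀ a, weight (φ a).image ≤ κ) : weight ψ.image ≤ κ := by
  choose ℬ hcard hℬ using fun a => exists_basis_pullback (φ a)
  refine weight_le_of_subbasis hκ (𝒮 := ⋃ a, ℬ a) ?_ ?_
  · calc #(⋃ a, ℬ a) ≤ #A * ⨆ a, #(ℬ a) := mk_iUnion_le _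
      _ ≤ κ * κ := mul_le_mul' hA (ciSup_le' fun a => (hcard a).trans (hφ a))
      _ = κ := mul_eq_self hκ
  · rw [h, generateFrom_iUnion]
    exact iInf_congr fun a =>
      @TopologicalSpace.IsTopologicalBasis.eq_generateFrom X (φ a).pullback _ (hℬ a)

/-- A continuous real function, regarded as a map onto its image. -/
theorem exists_mapFrom_real {h : X → ℝ} (hh : Continuous h) :
    ∃ φ : MapFrom X, weight φ.image ≤ ℵ₀ ∧
      ∀ V : Set ℝ, IsOpen V → IsOpen[φ.pullback] (h ⁻¹' V) := by
  obtain ⟨φ, e, he, hφ⟩ := exists_mapFrom hh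
  have hp := pullback_eq_induced he hφ
  refine ⟨φ, ?_, fun V hV => ?_⟩
  · obtain ⟨B, hBc, -, hB⟩ := TopologicalSpace.exists_countable_basis ℝ
    refine weight_le_of_subbasis le_rfl (𝒮 := Set.preimage h '' B)
      (Cardinal.le_aleph0_iff_set_countable.2 (hBc.image _)) ?_
    rw [hp, hB.eq_generateFrom, induced_generateFrom_eq]
  · rw [hp]
    exact ⟨V, hV, rfl⟩

end Maps

/-! ### The countable chain condition -/

/-- The countable chain condition, in the form in which it is used: every family of open sets has a
countable subfamily whose union is dense in the union of the whole family. -/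
def IsCCC (X : Type u) [TopologicalSpace X] : Prop :=
  ∀ 𝒜 : Set (Set X), (∀ P ∈ 𝒜, IsOpen P) → ∃ 𝒬 ⊆ 𝒜, 𝒬.Countable ∧ ⋃₀ 𝒜 ⊆ closure (⋃₀ 𝒬)

theorem exists_real_of_mem_isOpen {X : Type u} [TopologicalSpace X] [T35Space X] {D : Set X}
    (hD : IsOpen D) {x : X} (hx : x ∈ D) :
    ∃ h : X → ℝ, Continuous h ∧ x ∈ h ⁻¹' {0}ᶜ ∧ h ⁻¹' {0}ᶜ ⊆ D := by
  obtain ⟨f, hf, hfx, hfD⟩ := CompletelyRegularSpace.completely_regular_isOpen x D hD hx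
  refine ⟨fun y => 1 - f y, by fun_prop, by simp [hfx], fun y hy => ?_⟩
  by_contra hyD
  exact hy (by simp [hfD hyD])

section Lattice

variable {X : Type u} [tX : TopologicalSpace X] {Ψ : Set (MapFrom X)}

/-- Every map of countable weight can be refined by a member of the lattice, still of countable
weight, so that each of its open sets that meets `D` contains one of countably many points
`e ∈ D` whose cozero sets `{h e ≠ 0}` are open in the topology of the refinement. -/
theorem IsMultiplicativeLattice.exists_refinement_step (hΨ : IsMultiplicativeLattice Ψ) {D : Set X}
    {h : X → X → ℝ} (hh : ∀ x, Continuous (h x)) (φ : MapFrom X) (hφ : weight φ.image ≤ ℵ₀) :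
    ∃ φ' ∈ Ψ, weight φ'.image ≤ ℵ₀ ∧ φ'.pullback ≤ φ.pullback ∧ ∃ E ⊆ D, E.Countable ∧
      (∀ e ∈ E, IsOpen[φ'.pullback] (h e ⁻¹' {0}ᶜ)) ∧
      ∀ O, IsOpen[φ.pullback] O → (O ∩ D).Nonempty → (O ∩ E).Nonempty := by
  obtain ⟨ℬ, hcard, hℬ⟩ := exists_basis_pullback φ
  have hcount : Countable {B : ℬ // (B.1 ∩ D).Nonempty} := by
    have : Countable ℬ := Cardinal.le_aleph0_iff_set_countable.1 (hcard.trans hφ)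
    infer_instance
  choose e he using fun B : {B : ℬ // (B.1 ∩ D).Nonempty} => B.2
  choose r hrw hr using fun x => exists_mapFrom_real (hh x)
  let F : Option {B : ℬ // (B.1 ∩ D).Nonempty} → MapFrom X := fun o => o.elim φ fun B => r (e B)
  obtain ⟨f, hf⟩ := exists_isDiagonalProduct F
  have hfw : weight f.image ≤ ℵ₀ := by
    refine weight_le_of_pullback_eq_iInf hf.pullback_eq le_rfl (mk_le_aleph0_iff.2 inferInstance) ?_
    rintro (_ | B)
    · exact hφ
    · exact hrw _
  obtain ⟨φ', hφ', href, hw⟩ := hΨ.exists_refines f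
  rw [refines_iff, hf.pullback_eq] at href
  refine ⟨φ', hφ', hw.trans hfw, href.trans (iInf_le (fun o => (F o).pullback) none), Set.range e,
    ?_, Set.countable_range e, ?_, ?_⟩
  · rintro _ ⟨B, rfl⟩
    exact (he B).2
  · rintro _ ⟨B, rfl⟩
    exact href.trans (iInf_le (fun o => (F o).pullback) (some B)) _
      (hr (e B) _ isOpen_compl_singleton)
  · rintro O hO ⟨x, hxO, hxD⟩
    obtain ⟨B, hB, hxB, hBO⟩ := @TopologicalSpace.IsTopologicalBasis.exists_subset_of_mem_open
      X φ.pullback ℬ hℬ x O hxO hO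
    exact ⟨_, hBO (he ⟨⟨B, hB⟩, x, hxB, hxD⟩).1, Set.mem_range_self _⟩

/-- Iterating the refinement step countably often gives an open map `φ` for which countably many
members of the family are `φ`-saturated, and openness of `φ` makes their union dense. -/
theorem IsMultiplicativeLattice.isCCC [T35Space X] (hΨ : IsMultiplicativeLattice Ψ)
    (hopen : ∀ φ ∈ Ψ, IsOpenMap φ.toFun) : IsCCC X := by
  classical
  intro 𝒜 h𝒜
  have hex : ∀ x, ∃ h : X → ℝ, Continuous h ∧
      (x ∈ ⋃₀ 𝒜 → x ∈ h ⁻¹' {0}ᶜ ∧ ∃ P ∈ 𝒜, h ⁻¹' {0}ᶜ ⊆ P) := by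
    intro x
    by_cases hx : x ∈ ⋃₀ 𝒜
    · obtain ⟨P, hP, hxP⟩ := hx
      obtain ⟨h, hc, hxh, hhP⟩ := exists_real_of_mem_isOpen (h𝒜 P hP) hxP
      exact ⟨h, hc, fun _ => ⟨hxh, P, hP, hhP⟩⟩
    · exact ⟨fun _ => 0, continuous_const, fun h => (hx h).elim⟩
  choose h hc hh using hex
  choose next hnΨ hnw hnle E hED hEc hEo hEmeet using
    fun φ : {φ : MapFrom X // weight φ.image ≤ ℵ₀} =>
      hΨ.exists_refinement_step (D := ⋃₀ 𝒜) hc φ.1 φ.2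
  obtain ⟨φ₀, hφ₀, -⟩ := exists_mapFrom_real (X := X) (h := fun _ => 0) continuous_const
  let s : ℕ → {φ : MapFrom X // weight φ.image ≤ ℵ₀} := fun n =>
    Nat.rec ⟨φ₀, hφ₀⟩ (fun _ φ => ⟨next φ, hnw φ⟩) n
  have hanti : Antitone fun n => (s n).1.pullback := antitone_nat_of_succ_le fun n => hnle (s n)
  obtain ⟨φ, hφ, hφp⟩ := hΨ.exists_pullback_eq_iInf (φ := fun n => (s (n + 1)).1)
    fun n => hnΨ (s n)
  have hφs : φ.pullback = ⨅ n, (s n).1.pullback := by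
    rw [hφp]
    exact hanti.iInf_nat_add 1
  have hP : ∀ e : ⋃ n, E (s n), ∃ P ∈ 𝒜, h e ⁻¹' {0}ᶜ ⊆ P := fun e => by
    obtain ⟨n, hn⟩ := Set.mem_iUnion.1 e.2
    exact (hh _ (hED _ hn)).2
  choose P hP𝒜 hPsub using hP
  have hcount : Countable (⋃ n, E (s n)) := Set.countable_iUnion fun n => hEc (s n)
  refine ⟨Set.range P, Set.range_subset_iff.2 hP𝒜, Set.countable_range P, ?_⟩
  intro x hx
  refine mem_closure_iff.2 fun G hG hxG => ?_
  -- the saturation of `G` contains a set that is open already at a finite stage `n`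
  have hO : φ.toFun ⁻¹' (φ.toFun '' G) ∈ @nhds X φ.pullback x :=
    @IsOpen.mem_nhds X φ.pullback x _ (φ.isOpen_pullback_iff.2 ⟨_, hopen φ hφ G hG, rfl⟩)
      (Set.subset_preimage_image _ _ hxG)
  rw [hφs, nhds_iInf, Filter.mem_iInf_of_directed
    (directed_of_isDirected_le fun m n hmn => nhds_mono (hanti hmn))] at hO
  obtain ⟨n, hn⟩ := hO
  obtain ⟨O, hOsub, hOopen, hxO⟩ := (@mem_nhds_iff X (s n).1.pullback x _).1 hn
  obtain ⟨e, heO, heE⟩ := hEmeet (s n) O hOopen ⟨x, hxO, hx⟩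
  obtain ⟨v, hvG, hve⟩ := hOsub heO
  have hsat : IsOpen[φ.pullback] (h e ⁻¹' {0}ᶜ) := by
    rw [hφs]
    exact iInf_le (fun n => (s n).1.pullback) (n + 1) _ (hEo (s n) e heE)
  have hv : v ∈ h e ⁻¹' {0}ᶜ := φ.mem_of_isOpen_pullback hsat hve.symm (hh e (hED _ heE)).1
  exact ⟨v, hvG, P ⟨e, Set.mem_iUnion.2 ⟨n, heE⟩⟩, Set.mem_range_self _, hPsub _ hv⟩

end Lattice

/-- In a Tychonoff space with the countable chain condition, every open set is, up to its closure,
the preimage of an open set under a map of countable weight. -/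
theorem IsCCC.exists_mapFrom {X : Type u} [TopologicalSpace X] [T35Space X] (hX : IsCCC X)
    {D : Set X} (hD : IsOpen D) :
    ∃ f : MapFrom X, weight f.image ≤ ℵ₀ ∧
      ∃ V, IsOpen[f.pullback] V ∧ V ⊆ D ∧ D ⊆ closure V := by
  obtain ⟨𝒬, h𝒬, h𝒬c, hdense⟩ := hX
    {P | P ⊆ D ∧ ∃ h : X → ℝ, Continuous h ∧ h ⁻¹' {0}ᶜ = P} (by
      rintro _ ⟨-, h, hh, rfl⟩
      exact isOpen_compl_singleton.preimage hh)
  choose h hh hP using fun P : 𝒬 => (h𝒬 P.2).2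
  choose r hrw hr using fun P => exists_mapFrom_real (hh P)
  have hcount : Countable 𝒬 := h𝒬c
  obtain ⟨f, hf⟩ := exists_isDiagonalProduct r
  refine ⟨f, weight_le_of_pullback_eq_iInf hf.pullback_eq le_rfl (mk_le_aleph0_iff.2 hcount) hrw,
    ⋃₀ 𝒬, ?_, Set.sUnion_subset fun P hP => (h𝒬 hP).1, fun x hx => hdense ?_⟩
  · refine @isOpen_sUnion X f.pullback _ fun P hP' => ?_
    rw [hf.pullback_eq]
    refine iInf_le (fun P => (r P).pullback) ⟨P, hP'⟩ _ ?_
    have := hr ⟨P, hP'⟩ _ (isOpen_compl_singleton (x := (0 : ℝ)))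
    rwa [hP] at this
  · obtain ⟨g, hg, hxg, hgD⟩ := exists_real_of_mem_isOpen hD hx
    exact ⟨_, ⟨hgD, g, hg, rfl⟩, hxg⟩

/-! ### Perfect irreducible maps -/

section Irreducible

variable {Z : Type v} {X : Type u} {θ : Z → X}

/-- The set of the points whose fibre under `θ` lies in `U`. -/
def smallImage (θ : Z → X) (U : Set Z) : Set X := (θ '' Uᶜ)ᶜ

theorem mem_smallImage {U : Set Z} {x : X} : x ∈ smallImage θ U ↔ ∀ z, θ z = x → z ∈ U := by
  simp only [smallImage, Set.mem_compl_iff, Set.mem_image, not_exists, not_and]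
  exact forall_congr' fun z => by tauto

theorem preimage_smallImage_subset (U : Set Z) : θ ⁻¹' smallImage θ U ⊆ U :=
  fun z hz => mem_smallImage.1 hz z rfl

variable [TopologicalSpace Z]

theorem isOpen_smallImage [TopologicalSpace X] (hθ : IsClosedMap θ) {U : Set Z} (hU : IsOpen U) :
    IsOpen (smallImage θ U) :=
  (hθ _ hU.isClosed_compl).isOpen_compl

theorem IsIrreducibleMap.smallImage_nonempty (hθ : IsIrreducibleMap θ) {U : Set Z} (hU : IsOpen U)
    (hne : U.Nonempty) : (smallImage θ U).Nonempty := by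
  rw [smallImage, Set.nonempty_compl]
  intro h
  have := hθ.2 _ hU.isClosed_compl h
  simp [Set.compl_univ_iff.1 this] at hne

theorem IsIrreducibleMap.subset_closure_preimage_smallImage (hθ : IsIrreducibleMap θ) {U : Set Z}
    (hU : IsOpen U) : U ⊆ closure (θ ⁻¹' smallImage θ U) := by
  intro z hz
  refine mem_closure_iff.2 fun G hG hzG => ?_
  obtain ⟨x, hx⟩ := hθ.smallImage_nonempty (hG.inter hU) ⟨z, hzG, hz⟩
  obtain ⟨z', rfl⟩ := hθ.1 x
  have h := fun w hw => mem_smallImage.1 hx w hw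
  exact ⟨z', (h z' rfl).1, mem_smallImage.2 fun w hw => (h w hw).2⟩

variable [TopologicalSpace X]

theorem IsIrreducibleMap.preimage_subset_closure_preimage (hθ : IsIrreducibleMap θ)
    (hc : Continuous θ) (hcl : IsClosedMap θ) {A B : Set X} (hA : IsOpen A) (h : A ⊆ closure B) :
    θ ⁻¹' A ⊆ closure (θ ⁻¹' B) := by
  intro z hz
  refine mem_closure_iff.2 fun G hG hzG => ?_
  have hGA : IsOpen (G ∩ θ ⁻¹' A) := hG.inter (hA.preimage hc)
  obtain ⟨x, hx⟩ := hθ.smallImage_nonempty hGA ⟨z, hzG, hz⟩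
  have hxA : x ∈ A := by
    obtain ⟨z', rfl⟩ := hθ.1 x
    exact (mem_smallImage.1 hx z' rfl).2
  obtain ⟨y, hy, hyB⟩ := mem_closure_iff.1 (h hxA) _ (isOpen_smallImage hcl hGA) hx
  obtain ⟨z', rfl⟩ := hθ.1 y
  exact ⟨z', (mem_smallImage.1 hy z' rfl).1, hyB⟩

/-- The countable chain condition lifts along closed irreducible maps. -/
theorem IsCCC.of_isIrreducibleMap (hX : IsCCC X) (hθ : IsIrreducibleMap θ) (hc : Continuous θ)
    (hcl : IsClosedMap θ) : IsCCC Z := by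
  intro 𝒜 h𝒜
  obtain ⟨𝒬, h𝒬, h𝒬c, hdense⟩ := hX (smallImage θ '' 𝒜) (by
    rintro _ ⟨P, hP, rfl⟩
    exact isOpen_smallImage hcl (h𝒜 P hP))
  have hex : ∀ Q ∈ 𝒬, ∃ P ∈ 𝒜, smallImage θ P = Q := fun Q hQ => h𝒬 hQ
  choose! g hg𝒜 hg using hex
  refine ⟨g '' 𝒬, Set.image_subset_iff.2 fun Q hQ => hg𝒜 Q hQ, h𝒬c.image g, ?_⟩
  refine Set.sUnion_subset fun P hP => ?_
  refine (hθ.subset_closure_preimage_smallImage (h𝒜 P hP)).trans ?_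
  refine closure_minimal ((hθ.preimage_subset_closure_preimage hc hcl
    (isOpen_smallImage hcl (h𝒜 P hP))
    ((Set.subset_sUnion_of_mem (Set.mem_image_of_mem _ hP)).trans hdense)).trans
    (closure_mono ?_)) isClosed_closure
  rintro z ⟨Q, hQ, hzQ⟩
  refine ⟨g Q, Set.mem_image_of_mem g hQ, preimage_smallImage_subset (θ := θ) _ ?_⟩
  rw [Set.mem_preimage, hg Q hQ]
  exact hzQ

/-- The countable chain condition passes to continuous images. -/
theorem IsCCC.of_surjective (hZ : IsCCC Z) (hc : Continuous θ) (hs : Function.Surjective θ) :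
    IsCCC X := by
  intro 𝒜 h𝒜
  obtain ⟨𝒬, h𝒬, h𝒬c, hdense⟩ := hZ (Set.preimage θ '' 𝒜) (by
    rintro _ ⟨P, hP, rfl⟩
    exact (h𝒜 P hP).preimage hc)
  have hex : ∀ Q ∈ 𝒬, ∃ P ∈ 𝒜, θ ⁻¹' P = Q := fun Q hQ => h𝒬 hQ
  choose! g hg𝒜 hg using hex
  refine ⟨g '' 𝒬, Set.image_subset_iff.2 fun Q hQ => hg𝒜 Q hQ, h𝒬c.image g, ?_⟩
  rintro x ⟨P, hP, hxP⟩
  obtain ⟨z, rfl⟩ := hs x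
  refine map_mem_closure hc (hdense ⟨_, Set.mem_image_of_mem _ hP, hxP⟩) ?_
  rintro z ⟨Q, hQ, hzQ⟩
  refine ⟨g Q, Set.mem_image_of_mem g hQ, ?_⟩
  rw [← hg Q hQ] at hzQ
  exact hzQ

end Irreducible

/-! ### Topologies with the same closures of open sets -/

section Dominated

variable {Z : Type u}

/-- Every `s`-open set has the same closure in `Z` as some `t`-open set. If `s` and `t` are coarser
than the topology of `Z`, this says that the regular open sets of `Z` that come from `s` are among
those that come from `t`. -/
def ClosureDominated (s t : TopologicalSpace Z) [TopologicalSpace Z] : Prop :=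
  ∀ U, IsOpen[s] U → ∃ V, IsOpen[t] V ∧ closure U = closure V

theorem closure_inter_of_isOpen [TopologicalSpace Z] [ExtremallyDisconnected Z] {A B : Set Z}
    (hA : IsOpen A) (hB : IsOpen B) : closure (A ∩ B) = closure A ∩ closure B := by
  refine (closure_inter_subset_inter_closure A B).antisymm ?_
  have h₁ : closure A ∩ closure B ⊆ closure (closure A ∩ B) :=
    (ExtremallyDisconnected.open_closure A hA).inter_closure
  have h₂ : closure A ∩ B ⊆ closure (A ∩ B) := hB.closure_inter
  exact h₁.trans (closure_minimal h₂ isClosed_closure)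

theorem closureDominated_generateFrom {t : TopologicalSpace Z} [tZ : TopologicalSpace Z]
    [ExtremallyDisconnected Z] {𝒮 : Set (Set Z)} (h𝒮 : ∀ U ∈ 𝒮, IsOpen U) (ht : tZ ≤ t)
    (h : ∀ U ∈ 𝒮, ∃ V, IsOpen[t] V ∧ closure U = closure V) :
    ClosureDominated (TopologicalSpace.generateFrom 𝒮) t := by
  have hs : tZ ≤ TopologicalSpace.generateFrom 𝒮 := le_generateFrom h𝒮
  intro U hU
  induction hU with
  | basic U hU => exact h U hU
  | univ => exact ⟨Set.univ, @isOpen_univ _ t, rfl⟩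
  | inter A B hA hB ihA ihB =>
    obtain ⟨A', hA', hAA'⟩ := ihA
    obtain ⟨B', hB', hBB'⟩ := ihB
    refine ⟨A' ∩ B', @IsOpen.inter _ t _ _ hA' hB', ?_⟩
    rw [closure_inter_of_isOpen (hs _ hA) (hs _ hB),
      closure_inter_of_isOpen (ht _ hA') (ht _ hB'), hAA', hBB']
  | sUnion 𝒜 _ ih =>
    choose g hg hgc using ih
    refine ⟨⋃ (A) (hA : A ∈ 𝒜), g A hA,
      @isOpen_iUnion _ _ t _ fun A => @isOpen_iUnion _ _ t _ fun hA => hg A hA, ?_⟩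
    apply subset_antisymm
    · refine closure_minimal (Set.sUnion_subset fun A hA => subset_closure.trans ?_)
        isClosed_closure
      rw [hgc A hA]
      exact closure_mono (Set.subset_iUnion₂ (s := fun A hA => g A hA) A hA)
    · refine closure_minimal (Set.iUnion₂_subset fun A hA => subset_closure.trans ?_)
        isClosed_closure
      rw [← hgc A hA]
      exact closure_mono (Set.subset_sUnion_of_mem hA)

theorem closureDominated_iInf {A : Sort w} {s : A → TopologicalSpace Z} {t : TopologicalSpace Z}
    [tZ : TopologicalSpace Z] [ExtremallyDisconnected Z] (hs : ∀ a, tZ ≤ s a) (ht : tZ ≤ t)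
    (h : ∀ a, ClosureDominated (s a) t) : ClosureDominated (⨅ a, s a) t := by
  rw [← generateFrom_iUnion_isOpen]
  refine closureDominated_generateFrom (fun U hU => ?_) ht fun U hU => ?_
  all_goals obtain ⟨a, ha⟩ := Set.mem_iUnion.1 hU
  · exact hs a U ha
  · exact h a U ha

theorem ClosureDominated.mono_right {s t t' : TopologicalSpace Z} [TopologicalSpace Z]
    (h : ClosureDominated s t)
    (ht : t' ≤ t) :
    ClosureDominated s t' := fun U hU =>
  let ⟨V, hV, hUV⟩ := h U hU
  ⟨V, ht V hV, hUV⟩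

end Dominated

section CoAbsolute

variable {X Y Z : Type u} [TopologicalSpace X] [TopologicalSpace Y] [tZ : TopologicalSpace Z]
  {θ : Z → X} {η : Z → Y}

/-- The topology that a map `φ` of `X` induces on a space `Z` over `X`. -/
@[reducible] def MapFrom.pullbackAlong (φ : MapFrom X) (θ : Z → X) : TopologicalSpace Z :=
  TopologicalSpace.induced θ φ.pullback

theorem MapFrom.le_pullbackAlong (φ : MapFrom X) (hθ : Continuous θ) :
    tZ ≤ φ.pullbackAlong θ :=
  (continuous_iff_le_induced.1 hθ).trans (induced_mono φ.le_pullback)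

/-- The maps `φ` of `X` and `ψ` of `Y` have the same regular open sets, after both are lifted to the
common cover `Z`. -/
def Matched (θ : Z → X) (η : Z → Y) (φ : MapFrom X) (ψ : MapFrom Y) : Prop :=
  ClosureDominated (φ.pullbackAlong θ) (ψ.pullbackAlong η) ∧
    ClosureDominated (ψ.pullbackAlong η) (φ.pullbackAlong θ)

theorem closureDominated_pullbackAlong_iInf [ExtremallyDisconnected Z] (hθ : Continuous θ)
    (hη : Continuous η) {A : Type v} {φ : A → MapFrom X} {φ' : MapFrom X} {ψ : MapFrom Y}
    (hφ' : φ'.pullback = ⨅ a, (φ a).pullback)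
    (h : ∀ a, ClosureDominated ((φ a).pullbackAlong θ) (ψ.pullbackAlong η)) :
    ClosureDominated (φ'.pullbackAlong θ) (ψ.pullbackAlong η) := by
  rw [MapFrom.pullbackAlong, hφ', induced_iInf]
  exact closureDominated_iInf (fun a => (φ a).le_pullbackAlong hθ) (ψ.le_pullbackAlong hη) h

theorem Matched.iInf [ExtremallyDisconnected Z] (hθ : Continuous θ)
    (hη : Continuous η) {A : Type v} {φ : A → MapFrom X} {ψ : A → MapFrom Y} {φ' : MapFrom X}
    {ψ' : MapFrom Y} (hφ' : φ'.pullback = ⨅ a, (φ a).pullback)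
    (hψ' : ψ'.pullback = ⨅ a, (ψ a).pullback) (h : ∀ a, Matched θ η (φ a) (ψ a)) :
    Matched θ η φ' ψ' := by
  refine ⟨closureDominated_pullbackAlong_iInf hθ hη hφ' fun a => (h a).1.mono_right ?_,
    closureDominated_pullbackAlong_iInf hη hθ hψ' fun a => (h a).2.mono_right ?_⟩
  · exact induced_mono (hψ'.trans_le (iInf_le _ a))
  · exact induced_mono (hφ'.trans_le (iInf_le _ a))

/-! ### Semi-openness -/

/-- If `φ` is open and `ψ` is matched with `φ`, then `ψ` is semi-open: let `W` be the `φ`-image of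
the open set of `X` that corresponds to `U`. An open set `V` that corresponds to an open set well
inside `W` is contained in `ψ(U)`, since `ψ(η(θ⁻¹(x)))` depends on `φ(x)` only. -/
theorem Matched.isSemiOpenMap (hθ : IsProperMap θ) (hθi : IsIrreducibleMap θ) (hη : IsProperMap η)
    (hηs : Function.Surjective η) {φ : MapFrom X} {ψ : MapFrom Y} (hφ : IsOpenMap φ.toFun)
    (h : Matched θ η φ ψ) : IsSemiOpenMap ψ.toFun := by
  have hq : Continuous fun z => φ.toFun (θ z) := φ.continuous_toFun.comp hθ.continuous
  have hp : Continuous fun z => ψ.toFun (η z) := ψ.continuous_toFun.comp hη.continuous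
  intro U hU hUne
  set U' := smallImage θ (η ⁻¹' U)
  have hηU : IsOpen (η ⁻¹' U) := hU.preimage hη.continuous
  have hU'o : IsOpen U' := isOpen_smallImage hθ.isClosedMap hηU
  obtain ⟨x₀, hx₀⟩ : U'.Nonempty := hθi.smallImage_nonempty hηU (hUne.preimage hηs)
  -- regularity of `φ(X)` turns inclusions up to closure into true inclusions
  obtain ⟨C, ⟨hCn, hCc⟩, hCW⟩ := (closed_nhds_basis (φ.toFun x₀)).mem_iff.1
    ((hφ U' hU'o).mem_nhds (Set.mem_image_of_mem _ hx₀))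
  obtain ⟨_, hPo, hCP⟩ := h.1 ((fun z => φ.toFun (θ z)) ⁻¹' interior C)
    ⟨_, φ.isOpen_pullback_iff.2 ⟨_, isOpen_interior, rfl⟩, rfl⟩
  obtain ⟨_, hP', rfl⟩ := hPo
  obtain ⟨V, hV, rfl⟩ := ψ.isOpen_pullback_iff.1 hP'
  have hVW : ∀ z, ψ.toFun (η z) ∈ V → φ.toFun (θ z) ∈ φ.toFun '' U' := by
    intro z hz
    have hz' : z ∈ closure ((fun z => φ.toFun (θ z)) ⁻¹' interior C) := by
      rw [hCP]
      exact subset_closure hz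
    exact hCW (closure_minimal (Set.preimage_mono interior_subset) (hCc.preimage hq) hz')
  have hVne : V.Nonempty := by
    obtain ⟨z₀, rfl⟩ := hθi.1 x₀
    have hz₀ : z₀ ∈ closure ((fun z => φ.toFun (θ z)) ⁻¹' interior C) :=
      subset_closure (mem_interior_iff_mem_nhds.2 hCn)
    rw [hCP] at hz₀
    obtain ⟨z, hz⟩ := closure_nonempty_iff.1 ⟨z₀, hz₀⟩
    exact ⟨_, hz⟩
  suffices hsub : V ⊆ ψ.toFun '' U from hVne.mono (interior_maximal hsub hV)
  intro t ht
  obtain ⟨y, rfl⟩ := ψ.surjective_toFun t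
  obtain ⟨z, rfl⟩ := hηs y
  obtain ⟨x, hxU, hxz⟩ := hVW z ht
  by_contra hnot
  -- the compact set `ψ(η(θ⁻¹(x)))` lies in `ψ(U)`, so it misses the point `ψ(η(z))`
  set F := (fun z => ψ.toFun (η z)) '' (θ ⁻¹' {x})
  have hFc : IsClosed F := ((hθ.isCompact_preimage isCompact_singleton).image hp).isClosed
  have htF : ψ.toFun (η z) ∈ Fᶜ := by
    rintro ⟨z', hz', hzz'⟩
    refine hnot ⟨η z', mem_smallImage.1 hxU z' hz', hzz'⟩
  obtain ⟨C₁, ⟨hC₁n, hC₁c⟩, hC₁F⟩ := (closed_nhds_basis (ψ.toFun (η z))).mem_iff.1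
    (hFc.isOpen_compl.mem_nhds htF)
  obtain ⟨_, hQo, hCQ⟩ := h.2 ((fun z => ψ.toFun (η z)) ⁻¹' interior C₁)
    ⟨_, ψ.isOpen_pullback_iff.2 ⟨_, isOpen_interior, rfl⟩, rfl⟩
  obtain ⟨_, hQ', rfl⟩ := hQo
  obtain ⟨W₁, hW₁, rfl⟩ := φ.isOpen_pullback_iff.1 hQ'
  have hzW₁ : z ∈ closure (θ ⁻¹' (φ.toFun ⁻¹' W₁)) := by
    rw [← hCQ]
    exact subset_closure (mem_interior_iff_mem_nhds.2 hC₁n)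
  have hxW₁ : x ∈ closure (φ.toFun ⁻¹' W₁) := by
    rw [← hφ.preimage_closure_eq_closure_preimage φ.continuous_toFun, Set.mem_preimage, hxz]
    exact map_mem_closure (f := fun z => φ.toFun (θ z)) hq hzW₁ fun _ h => h
  -- since `θ` is closed and onto, `x` is the image of a point of the closure in `Z`
  obtain ⟨z₁, hz₁, rfl⟩ : x ∈ θ '' closure (θ ⁻¹' (φ.toFun ⁻¹' W₁)) := by
    refine closure_minimal ?_ (hθ.isClosedMap _ isClosed_closure) hxW₁
    intro x' hx'
    obtain ⟨z', rfl⟩ := hθi.1 x'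
    exact ⟨z', subset_closure hx', rfl⟩
  rw [← hCQ] at hz₁
  exact hC₁F (closure_minimal (Set.preimage_mono interior_subset) (hC₁c.preimage hp) hz₁)
    ⟨z₁, rfl, rfl⟩

end CoAbsolute

/-! ### Factorisation through matched maps -/

theorem exists_seq_subbasis {X : Type u} [TopologicalSpace X] {φ : MapFrom X}
    (hφ : weight φ.image ≤ ℵ₀) :
    ∃ b : ℕ → Set X, (∀ n, IsOpen[φ.pullback] (b n)) ∧
      φ.pullback = TopologicalSpace.generateFrom (Set.range b) := by
  obtain ⟨ℬ, hcard, hℬ⟩ := exists_basis_pullback φ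
  have hc : (insert Set.univ ℬ).Countable :=
    (Cardinal.le_aleph0_iff_set_countable.1 (hcard.trans hφ)).insert _
  obtain ⟨b, hb⟩ := hc.exists_eq_range (Set.insert_nonempty _ _)
  have hgen : φ.pullback = TopologicalSpace.generateFrom (Set.range b) := by
    rw [← hb, generateFrom_insert_univ]
    exact @TopologicalSpace.IsTopologicalBasis.eq_generateFrom X φ.pullback _ hℬ
  refine ⟨b, fun n => ?_, hgen⟩
  rw [hgen]
  exact .basic _ (Set.mem_range_self n)

section Factorisation

variable {X Y Z : Type u} [TopologicalSpace X] [TopologicalSpace Y] [tZ : TopologicalSpace Z]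
  {θ : Z → X} {η : Z → Y}

/-- If `X` satisfies the countable chain condition, every regular open set of `Z` comes from a map
of `X` of countable weight. -/
theorem IsCCC.exists_mapFrom_closure_eq [T35Space X] (hX : IsCCC X) (hθ : IsProperMap θ)
    (hθi : IsIrreducibleMap θ) {D : Set Z} (hD : IsOpen D) :
    ∃ f : MapFrom X, weight f.image ≤ ℵ₀ ∧
      ∃ V, IsOpen[f.pullbackAlong θ] V ∧ closure D = closure V := by
  have hD' : IsOpen (smallImage θ D) := isOpen_smallImage hθ.isClosedMap hD
  obtain ⟨f, hf, V, hV, hVD, hDV⟩ := hX.exists_mapFrom hD'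
  refine ⟨f, hf, θ ⁻¹' V, ⟨V, hV, rfl⟩, subset_antisymm ?_ (closure_mono ?_)⟩
  · refine closure_minimal ((hθi.subset_closure_preimage_smallImage hD).trans
      (closure_minimal ?_ isClosed_closure)) isClosed_closure
    exact hθi.preimage_subset_closure_preimage hθ.continuous hθ.isClosedMap hD' hDV
  · exact (Set.preimage_mono hVD).trans (preimage_smallImage_subset D)

theorem closureDominated_pullbackAlong_generateFrom [ExtremallyDisconnected Z]
    (hθ : Continuous θ) (hη : Continuous η) {φ : MapFrom X} {ψ : MapFrom Y} {𝒮 : Set (Set X)}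
    (h𝒮 : φ.pullback = TopologicalSpace.generateFrom 𝒮)
    (h : ∀ U ∈ 𝒮, ∃ V, IsOpen[ψ.pullbackAlong η] V ∧ closure (θ ⁻¹' U) = closure V) :
    ClosureDominated (φ.pullbackAlong θ) (ψ.pullbackAlong η) := by
  have hopen : ∀ U ∈ 𝒮, IsOpen U := fun U hU => φ.le_pullback U (by rw [h𝒮]; exact .basic U hU)
  rw [MapFrom.pullbackAlong, h𝒮, induced_generateFrom_eq]
  refine closureDominated_generateFrom ?_ (ψ.le_pullbackAlong hη) ?_
  · rintro _ ⟨U, hU, rfl⟩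
    exact (hopen U hU).preimage hθ
  · rintro _ ⟨U, hU, rfl⟩
    exact h U hU

/-- Every map `f` of `Y` factors through a map `ψ` of the same weight that is matched with a member
of the lattice. Starting from a subbase of `f(Y)`, lifted to `Z`, a family of open sets of `Z` is
closed under passing from a set `D` to the members of countable subbases of two maps of countable
weight, one of `X` in the lattice and one of `Y`, from which the regular open set of `D` comes. The
diagonal products of these maps are matched. -/
theorem exists_matched_refines [T35Space X] [T35Space Y] [ExtremallyDisconnected Z]
    {Ψ : Set (MapFrom X)} (hΨ : IsMultiplicativeLattice Ψ) (hX : IsCCC X) (hY : IsCCC Y)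
    (hθ : IsProperMap θ) (hθi : IsIrreducibleMap θ) (hη : IsProperMap η)
    (hηi : IsIrreducibleMap η) (f : MapFrom Y) :
    ∃ φ ∈ Ψ, ∃ ψ : MapFrom Y, Matched θ η φ ψ ∧ Refines ψ f ∧
      weight ψ.image ≤ weight f.image := by
  have hfX : ∀ D : TopologicalSpace.Opens Z, ∃ φ ∈ Ψ, weight φ.image ≤ ℵ₀ ∧
      ∃ V, IsOpen[φ.pullbackAlong θ] V ∧ closure (D : Set Z) = closure V := by
    intro D
    obtain ⟨f, hf, V, hV, hDV⟩ := hX.exists_mapFrom_closure_eq hθ hθi D.2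
    obtain ⟨φ, hφ, hφf, hw⟩ := hΨ.exists_refines f
    exact ⟨φ, hφ, hw.trans hf, V, induced_mono (refines_iff.1 hφf) V hV, hDV⟩
  choose gX hgΨ hgXw VX hVX hVXc using hfX
  choose gY hgYw VY hVY hVYc using fun D : TopologicalSpace.Opens Z =>
    hY.exists_mapFrom_closure_eq hη hηi D.2
  choose bX hbXo hbX using fun D => exists_seq_subbasis (hgXw D)
  choose bY hbYo hbY using fun D => exists_seq_subbasis (hgYw D)
  obtain ⟨ℬ, hℬcard, hℬ⟩ := exists_basis_pullback f
  have hℬo : ∀ B : ℬ, IsOpen (B : Set Y) := fun B => f.le_pullback _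
    (@TopologicalSpace.IsTopologicalBasis.isOpen Y f.pullback B ℬ hℬ B.2)
  -- the closed-off family is indexed by words in the countably many operations
  let op : ℕ ⊕ ℕ → TopologicalSpace.Opens Z → TopologicalSpace.Opens Z := fun k D => k.elim
    (fun n => ⟨θ ⁻¹' bX D n, ((gX D).le_pullback _ (hbXo D n)).preimage hθ.continuous⟩)
    (fun n => ⟨η ⁻¹' bY D n, ((gY D).le_pullback _ (hbYo D n)).preimage hη.continuous⟩)
  let C : ℬ × List (ℕ ⊕ ℕ) → TopologicalSpace.Opens Z := fun a =>
    a.2.foldr op ⟨η ⁻¹' a.1.1, (hℬo a.1).preimage hη.continuous⟩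
  obtain ⟨φ, hφ, hφp⟩ := hΨ.exists_pullback_eq_iInf (φ := fun a => gX (C a)) fun a => hgΨ _
  let F : Option (ℬ × List (ℕ ⊕ ℕ)) → MapFrom Y := fun o => o.elim f fun a => gY (C a)
  obtain ⟨ψ, hψ⟩ := exists_isDiagonalProduct F
  have hψp : ψ.pullback = ⨅ o, (F o).pullback := hψ.pullback_eq
  have hφle : ∀ a, φ.pullbackAlong θ ≤ (gX (C a)).pullbackAlong θ := fun a =>
    induced_mono (hφp.trans_le (iInf_le _ a))
  have hψle : ∀ a, ψ.pullbackAlong η ≤ (gY (C a)).pullbackAlong η := fun a =>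
    induced_mono (hψp.trans_le (iInf_le (fun o => (F o).pullback) (some a)))
  have hκ : ℵ₀ ≤ weight f.image := le_max_left _ _
  refine ⟨φ, hφ, ψ, ⟨?_, ?_⟩, ?_, ?_⟩
  · refine closureDominated_pullbackAlong_iInf hθ.continuous hη.continuous hφp fun a => ?_
    refine closureDominated_pullbackAlong_generateFrom hθ.continuous hη.continuous (hbX (C a)) ?_
    rintro _ ⟨n, rfl⟩
    exact ⟨_, hψle (a.1, .inl n :: a.2) _ (hVY _), hVYc (C (a.1, .inl n :: a.2))⟩
  · refine closureDominated_pullbackAlong_iInf hη.continuous hθ.continuous hψp ?_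
    rintro (_ | a)
    · refine closureDominated_pullbackAlong_generateFrom hη.continuous hθ.continuous
        (@TopologicalSpace.IsTopologicalBasis.eq_generateFrom Y f.pullback ℬ hℬ) fun B hB => ?_
      exact ⟨_, hφle (⟨B, hB⟩, []) _ (hVX _), hVXc (C (⟨B, hB⟩, []))⟩
    · refine closureDominated_pullbackAlong_generateFrom hη.continuous hθ.continuous
        (hbY (C a)) ?_
      rintro _ ⟨n, rfl⟩
      exact ⟨_, hφle (a.1, .inr n :: a.2) _ (hVX _), hVXc (C (a.1, .inr n :: a.2))⟩
  · exact refines_iff.2 (hψp.trans_le (iInf_le (fun o => (F o).pullback) none))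
  · refine weight_le_of_pullback_eq_iInf hψp hκ ?_ ?_
    · rw [mk_option, mk_prod, lift_uzero]
      refine add_le_of_le hκ ?_ (one_le_aleph0.trans hκ)
      refine mul_le_of_le hκ hℬcard (le_trans ?_ hκ)
      simp
    · rintro (_ | a)
      · exact le_rfl
      · exact (hgYw _).trans hκ

end Factorisation

end CoAbs

theorem theorem2p2 (X Y : Type u) [TopologicalSpace X] [T35Space X]
    [TopologicalSpace Y] [T35Space Y]
    (hX : ∃ Ψ : Set (CoAbs.MapFrom X), CoAbs.IsMultiplicativeLattice Ψ ∧
      ∀ φ ∈ Ψ, IsOpenMap φ.toFun)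
    (hXY : CoAbs.CoAbsolute X Y) :
    ∃ Ψ : Set (CoAbs.MapFrom Y), CoAbs.IsMultiplicativeLattice Ψ ∧
      ∀ φ ∈ Ψ, CoAbs.IsSemiOpenMap φ.toFun := by
  obtain ⟨Ψ, hΨ, hopen⟩ := hX
  obtain ⟨Z, _, ⟨-, _, θ, hθ, hθi⟩, -, -, η, hη, hηi⟩ := hXY
  have hcX : CoAbs.IsCCC X := hΨ.isCCC hopen
  have hcY : CoAbs.IsCCC Y :=
    (hcX.of_isIrreducibleMap hθi hθ.continuous hθ.isClosedMap).of_surjective hη.continuous hηi.1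
  refine ⟨{ψ | ∃ φ ∈ Ψ, CoAbs.Matched θ η φ ψ}, ⟨fun f => ?_, fun S hS => ?_⟩, ?_⟩
  · obtain ⟨φ, hφ, ψ, hm, hr, hw⟩ := CoAbs.exists_matched_refines hΨ hcX hcY hθ hθi hη hηi f
    exact ⟨ψ, ⟨φ, hφ, hm⟩, hr, hw⟩
  · choose g hgΨ hg using fun ψ : S => hS ψ.2
    obtain ⟨φ, hφ, hφp⟩ := hΨ.exists_pullback_eq_iInf hgΨ
    obtain ⟨ψ, hψ⟩ := CoAbs.exists_isDiagonalProduct fun ψ : S => ψ.1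
    exact ⟨ψ, ⟨φ, hφ, .iInf hθ.continuous hη.continuous hφp hψ.pullback_eq hg⟩, hψ⟩
  · rintro ψ ⟨φ, hφ, hm⟩
    exact hm.isSemiOpenMap hθ hθi hη hηi.1 (hopen φ hφ)
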